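/- Let $\mathcal H$ be a separable complex Hilbert space, and write $\mathbb C_+=\{\lambda\in\mathbb C:\operatorname{Im}\lambda>0\}$. Let $\mathbf L_2(\mathbb R)\otimes\mathcal H$ be the space of square-integrable $\mathcal H$-valued functions on $\mathbb R$ (modulo null sets). Let $\mathbf H_2(\mathbb C_+)\otimes\mathcal H$ be the Hardy space of analytic functions $F:\mathbb C_+\to\mathcal H$ with $\sup_{y>0}\int_{\mathbb R}\|F(x+iy)\|^2\,dx<\infty$. It is identified with a subspace of $\mathbf L_2(\mathbb R)\otimes\mathcal H$ through boundary values $f=\lim_{y\downarrow0}F(\cdot+iy)$ (limit in $\mathbf L_2(\mathbb R)\otimes\mathcal H$); one writes $f(\lambda)$ for $F(\lambda)$, $\lambda\in\mathbb C_+$. Denote by $\mathbf L(\mathcal H)$ the Banach space of bounded linear operators from $\mathcal H$ into itself. Let $X$ be a bounded linear operator from $\mathbf L_2(\mathbb R)\otimes\mathcal H$ into itself. Assume that whenever $f\in\mathbf L_2(\mathbb R)\otimes\mathcal H$ vanishes (almost everywhere) outside an interval $I\subset\mathbb R$, then $Xf$ vanishes (almost everywhere) outside the same interval $I$. Assume moreover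 that $$X\bigl(\mathbf H_2(\mathbb C_+)\otimes\mathcal H\bigr)\subset\mathbf H_2(\mathbb C_+)\otimes\mathcal H .$$ Then there exists an $\mathbf L(\mathcal H)$-valued function $S$, analytic in $\mathbb C_+$ and bounded in norm there ($\sup_{\lambda\in\mathbb C_+}\|S(\lambda)\|<\infty$), such that $$(Xf)(\lambda)=S(\lambda)f(\lambda),\qquad f\in\mathbf H_2(\mathbb C_+)\otimes\mathcal H,\ \lambda\in\mathbb C_+ .$$ -/

import Mathlib

open MeasureTheory Filter Topology
open scoped ENNReal NNReal

/-- The space `L₂(ℝ) ⊗ H`: square integrable (classes of) `H`-valued functions on the line. -/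
abbrev L2R (H : Type*) [NormedAddCommGroup H] : Type _ :=
  Lp H 2 (volume : Measure ℝ)

/-- The restriction `x ↦ F (x + i y)` of `F` to the horizontal line at height `y`. -/
def slice {H : Type*} (F : ℂ → H) (y : ℝ) : ℝ → H :=
  fun x => F ((x : ℂ) + (y : ℂ) * Complex.I)

/-- `F` belongs to the Hardy space `H₂(ℂ₊) ⊗ H`: it is an `H`-valued analytic function on `ℂ₊`
whose horizontal slices are bounded in `L₂(ℝ) ⊗ H`. Values of `F` outside `ℂ₊` are irrelevant. -/
structure IsHardyTwo {H : Type*} [NormedAddCommGroup H] [NormedSpace ℂ H] (F : ℂ → H) :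
    Prop where
  analytic : DifferentiableOn ℂ F UpperHalfPlane.upperHalfPlaneSet
  bounded : ∃ C : ℝ≥0, ∀ y : ℝ, 0 < y → eLpNorm (slice F y) 2 volume ≤ C

/-- `F` is a function of the Hardy space `H₂(ℂ₊) ⊗ H` and `f` is its boundary value function:
the slices `F (· + i y)` converge to `f` in `L₂(ℝ) ⊗ H` as `y ↓ 0`. -/
structure IsHardyExtension {H : Type*} [NormedAddCommGroup H] [NormedSpace ℂ H]
    (F : ℂ → H) (f : L2R H) : Prop where
  hardy : IsHardyTwo F
  boundary : Tendsto (fun y : ℝ => eLpNorm (fun x : ℝ => slice F y x - f x) 2 volume)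
    (𝓝[>] 0) (𝓝 0)

theorem IsHardyTwo.aestronglyMeasurable_slice {H : Type*} [NormedAddCommGroup H]
    [NormedSpace ℂ H] {F : ℂ → H} (hF : IsHardyTwo F) {y : ℝ} (hy : 0 < y) :
    AEStronglyMeasurable (slice F y) volume := by
  have hc : Continuous (slice F y) := by
    refine hF.analytic.continuousOn.comp_continuous (by fun_prop) ?_
    intro x
    simpa [UpperHalfPlane.upperHalfPlaneSet] using hy
  exact hc.aestronglyMeasurable

theorem IsHardyExtension.zero {H : Type*} [NormedAddCommGroup H] [NormedSpace ℂ H] :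
    IsHardyExtension (fun _ : ℂ => (0 : H)) (0 : L2R H) := by
  refine ⟨⟨differentiableOn_const _, 0, fun y _ => ?_⟩, ?_⟩
  · have : slice (fun _ : ℂ => (0 : H)) y = 0 := rfl
    simp [this]
  · refine tendsto_const_nhds.congr fun y => ?_
    symm
    rw [eLpNorm_congr_ae (g := fun _ => (0 : H))]
    · simp
    · filter_upwards [Lp.coeFn_zero H 2 (volume : Measure ℝ)] with x hx
      simp [slice]

theorem IsHardyExtension.add {H : Type*} [NormedAddCommGroup H] [NormedSpace ℂ H]
    {F G : ℂ → H} {f g : L2R H} (hF : IsHardyExtension F f) (hG : IsHardyExtension G g) :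
    IsHardyExtension (F + G) (f + g) := by
  obtain ⟨C, hC⟩ := hF.hardy.bounded
  obtain ⟨D, hD⟩ := hG.hardy.bounded
  refine ⟨⟨hF.hardy.analytic.add hG.hardy.analytic, C + D, fun y hy => ?_⟩, ?_⟩
  · have h : slice (F + G) y = slice F y + slice G y := rfl
    rw [h, ENNReal.coe_add]
    exact (eLpNorm_add_le (hF.hardy.aestronglyMeasurable_slice hy)
      (hG.hardy.aestronglyMeasurable_slice hy) (by norm_num)).trans
      (add_le_add (hC y hy) (hD y hy))
  · have hlim := hF.boundary.add hG.boundary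
    rw [add_zero] at hlim
    refine tendsto_of_tendsto_of_tendsto_of_le_of_le' tendsto_const_nhds hlim
      (Eventually.of_forall fun _ => zero_le) ?_
    filter_upwards [self_mem_nhdsWithin] with y hy
    have h : (fun x : ℝ => slice (F + G) y x - (f + g : L2R H) x) =ᵐ[volume]
        (fun x : ℝ => slice F y x - f x) + (fun x : ℝ => slice G y x - g x) := by
      filter_upwards [Lp.coeFn_add f g] with x hx
      simp only [slice, Pi.add_apply, hx]
      abel
    rw [eLpNorm_congr_ae h]
    exact eLpNorm_add_le
      ((hF.hardy.aestronglyMeasurable_slice hy).sub (Lp.aestronglyMeasurable f))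
      ((hG.hardy.aestronglyMeasurable_slice hy).sub (Lp.aestronglyMeasurable g)) (by norm_num)

theorem IsHardyExtension.const_smul {H : Type*} [NormedAddCommGroup H] [NormedSpace ℂ H]
    {F : ℂ → H} {f : L2R H} (c : ℂ) (hF : IsHardyExtension F f) :
    IsHardyExtension (c • F) (c • f) := by
  obtain ⟨C, hC⟩ := hF.hardy.bounded
  refine ⟨⟨hF.hardy.analytic.const_smul c, ‖c‖₊ * C, fun y hy => ?_⟩, ?_⟩
  · have h : slice (c • F) y = c • slice F y := rfl
    rw [h, eLpNorm_const_smul, ENNReal.coe_mul]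
    exact mul_le_mul_right (hC y hy) _
  · have hlim := ENNReal.Tendsto.const_mul (a := ‖c‖ₑ) hF.boundary (Or.inr enorm_ne_top)
    rw [mul_zero] at hlim
    refine hlim.congr fun y => ?_
    rw [← eLpNorm_const_smul]
    refine eLpNorm_congr_ae ?_
    filter_upwards [Lp.coeFn_smul c f] with x hx
    simp only [slice, Pi.smul_apply, hx, smul_sub]

/-- The Hardy space `H₂(ℂ₊) ⊗ H`, identified through boundary values with a subspace of
`L₂(ℝ) ⊗ H`. -/
def hardySpace (H : Type*) [NormedAddCommGroup H] [NormedSpace ℂ H] :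
    Submodule ℂ (L2R H) where
  carrier := {f | ∃ F : ℂ → H, IsHardyExtension F f}
  zero_mem' := ⟨_, IsHardyExtension.zero⟩
  add_mem' := by
    rintro f g ⟨F, hF⟩ ⟨G, hG⟩
    exact ⟨_, hF.add hG⟩
  smul_mem' := by
    rintro c f ⟨F, hF⟩
    exact ⟨_, hF.const_smul c⟩

/-- `f` vanishes (almost everywhere) outside `I`. -/
def VanishesOutside {H : Type*} [NormedAddCommGroup H] (f : L2R H) (I : Set ℝ) : Prop :=
  ∀ᵐ t : ℝ, t ∉ I → f t = 0

/-- `X` is a transformation of simple type: if `f` vanishes outside an interval, then `X f`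
vanishes outside the same interval. -/
def IsSimpleType {H : Type*} [NormedAddCommGroup H] [NormedSpace ℂ H]
    (X : L2R H →L[ℂ] L2R H) : Prop :=
  ∀ I : Set ℝ, I.OrdConnected → ∀ f : L2R H, VanishesOutside f I → VanishesOutside (X f) I

/-! Preserving support in intervals makes `X` local: comparing averages of `‖X f‖²` and `‖f‖²` over
shrinking intervals gives `‖X f t‖ ≤ ‖X‖ * ‖f t‖` almost everywhere (`norm_apply_ae_le`). Applied to
`g - c • f` with `c` close to `φ t`, this shows that `X` commutes with multiplication by scalar
functions (`apply_ae_eq_smul`).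

If a Hardy function vanishes at `w`, then its boundary function is `(t - w) • d` with `d` again in
the Hardy space (`IsHardyExtension.dslope`). Its image is `(t - w) • X d` with `X d` Hardy, so the
image also vanishes at `w`; the link between boundary values and values at `w` is the Poisson
formula, a consequence of the vanishing of Cauchy integrals in the lower half plane. Hence `(X
f)(w)` depends only on `f(w)`, and linearly, which defines `S(w)`.

To bound `S`, a prescribed value at `w` is realized by a multiple of `(t - conj w)⁻¹`. To see
analyticity, it is realized by a multiple of `(t + i)⁻¹`, whose pole does not move with `w`. This
gives strong analyticity, which boundedness upgrades to analyticity in norm. -/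

theorem ofReal_integral_norm_sq {α E : Type*} [MeasurableSpace α] [NormedAddCommGroup E]
    {μ : Measure α} {g : α → E} (hg : MemLp g 2 μ) :
    ENNReal.ofReal (∫ x, ‖g x‖ ^ 2 ∂μ) = eLpNorm g 2 μ ^ 2 := by
  rw [ofReal_integral_eq_lintegral_ofReal (hg.integrable_norm_pow two_ne_zero) (by filter_upwards; simp)]
  have := eLpNorm_nnreal_pow_eq_lintegral (f := g) (μ := μ) (p := 2) (by norm_num)
  norm_num at this
  rw [this]
  refine lintegral_congr fun x => ?_
  rw [ENNReal.ofReal_pow (norm_nonneg _), ofReal_norm]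

/-! ### Locality of operators of simple type -/

namespace IsSimpleType

variable {H : Type*} [NormedAddCommGroup H] [NormedSpace ℂ H] {X : L2R H →L[ℂ] L2R H}

/-- On an interval `I`, the values of `X f` are those of `X (1_I f)`. -/
theorem apply_indicator_ae_eq (hX : IsSimpleType X) (f : L2R H) (a b : ℝ) :
    ∀ᵐ t : ℝ, t ∈ Set.Icc a b →
      X f t = X ((Lp.memLp f).indicator (measurableSet_Icc (a := a) (b := b))).toLp t := by
  set fI : L2R H := ((Lp.memLp f).indicator (measurableSet_Icc (a := a) (b := b))).toLp with hfI
  set fa : L2R H := ((Lp.memLp (f - fI)).indicator (measurableSet_Iio (a := a))).toLp with hfa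
  set fb : L2R H := ((Lp.memLp (f - fI)).indicator (measurableSet_Ici (a := a))).toLp with hfb
  have eI : fI =ᵐ[volume] _ := MemLp.coeFn_toLp _
  have ea : fa =ᵐ[volume] _ := MemLp.coeFn_toLp _
  have eb : fb =ᵐ[volume] _ := MemLp.coeFn_toLp _
  have hsum : f = fI + (fa + fb) := by
    apply Lp.ext
    filter_upwards [Lp.coeFn_add fI (fa + fb), Lp.coeFn_add fa fb, Lp.coeFn_sub f fI, ea, eb]
      with t h1 h2 h3 h4 h5
    rw [h1, Pi.add_apply, h2, Pi.add_apply, h4, h5]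
    by_cases ht : t < a
    · rw [Set.indicator_of_mem (by exact ht), Set.indicator_of_notMem (by simpa using ht), h3]
      simp
    · rw [Set.indicator_of_notMem (by exact ht), Set.indicator_of_mem (by simpa using ht), h3]
      simp
  -- As `f - fI` vanishes on `[a, b]`, its two pieces are supported on intervals disjoint from `[a,
  -- b]`; so are their images under `X`.
  have va : VanishesOutside (X fa) (Set.Iio a) := by
    refine hX _ Set.ordConnected_Iio _ ?_
    filter_upwards [ea] with t h ht
    rw [h, Set.indicator_of_notMem ht]
  have vb : VanishesOutside (X fb) (Set.Ioi b ∩ Set.Ici a) := by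
    refine hX _ (Set.ordConnected_Ioi.inter Set.ordConnected_Ici) _ ?_
    filter_upwards [eb, Lp.coeFn_sub f fI, eI] with t h h2 h3 ht
    rw [h]
    by_cases hta : a ≤ t
    · have : t ≤ b := by
        by_contra hb
        exact ht ⟨not_le.1 hb, hta⟩
      rw [Set.indicator_of_mem (by exact hta), h2, Pi.sub_apply, h3,
        Set.indicator_of_mem (Set.mem_Icc.2 ⟨hta, this⟩), sub_self]
    · simp [Set.indicator, hta]
  have hXs : X f = X fI + (X fa + X fb) := by rw [← map_add, ← map_add, ← hsum]
  filter_upwards [va, vb, Lp.coeFn_add (X fI) (X fa + X fb), Lp.coeFn_add (X fa) (X fb)]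
    with t h1 h2 h3 h4 ht
  rw [hXs, h3, Pi.add_apply, h4, Pi.add_apply, h1 (by simpa using ht.1),
    h2 (fun h => absurd h.1 (by simpa using ht.2))]
  simp

theorem eLpNorm_restrict_apply_le (hX : IsSimpleType X) (f : L2R H) (a b : ℝ) :
    eLpNorm (X f) 2 (volume.restrict (Set.Icc a b)) ≤
      ‖X‖ₑ * eLpNorm f 2 (volume.restrict (Set.Icc a b)) := by
  set fI : L2R H := ((Lp.memLp f).indicator (measurableSet_Icc (a := a) (b := b))).toLp with hfI
  calc eLpNorm (X f) 2 (volume.restrict (Set.Icc a b))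
      = eLpNorm (X fI) 2 (volume.restrict (Set.Icc a b)) := by
        refine eLpNorm_congr_ae ?_
        exact (ae_restrict_iff' measurableSet_Icc).2 (hX.apply_indicator_ae_eq f a b)
    _ ≤ eLpNorm (X fI) 2 volume := eLpNorm_mono_measure _ Measure.restrict_le_self
    _ = ‖X fI‖ₑ := (Lp.enorm_def _).symm
    _ ≤ ‖X‖ₑ * ‖fI‖ₑ := X.le_opENorm fI
    _ = ‖X‖ₑ * eLpNorm f 2 (volume.restrict (Set.Icc a b)) := by
        rw [Lp.enorm_def, eLpNorm_congr_ae (MemLp.coeFn_toLp _),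
          eLpNorm_indicator_eq_eLpNorm_restrict measurableSet_Icc]

/-- Operators of simple type are local. -/
theorem norm_apply_ae_le (hX : IsSimpleType X) (f : L2R H) :
    ∀ᵐ t : ℝ, ‖X f t‖ ≤ ‖X‖ * ‖f t‖ := by
  have hint : ∀ g : L2R H, Integrable (fun t => ‖g t‖ ^ 2) := fun g =>
    (Lp.memLp g).integrable_norm_pow two_ne_zero
  have key : ∀ a b : ℝ, ∫ t in Set.Icc a b, ‖X f t‖ ^ 2 ≤
      ‖X‖ ^ 2 * ∫ t in Set.Icc a b, ‖f t‖ ^ 2 := by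
    intro a b
    have h := pow_le_pow_left' (hX.eLpNorm_restrict_apply_le f a b) 2
    rw [mul_pow, ← ofReal_integral_norm_sq ((Lp.memLp _).restrict _),
      ← ofReal_integral_norm_sq ((Lp.memLp _).restrict _), ← ofReal_norm,
      ← ENNReal.ofReal_pow (norm_nonneg _), ← ENNReal.ofReal_mul (by positivity)] at h
    exact (ENNReal.ofReal_le_ofReal_iff
      (mul_nonneg (by positivity) (integral_nonneg fun _ => by positivity))).1 h
  -- Lebesgue differentiation turns the inequality between integrals over intervals into a pointwise
  -- one.
  have h1 := IsUnifLocDoublingMeasure.ae_tendsto_average (μ := (volume : Measure ℝ))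
    (hint (X f)).locallyIntegrable 1
  have h2 := IsUnifLocDoublingMeasure.ae_tendsto_average (μ := (volume : Measure ℝ))
    (hint f).locallyIntegrable 1
  filter_upwards [h1, h2] with t ht1 ht2
  have hδ : Tendsto (fun n : ℕ => 1 / ((n : ℝ) + 1)) atTop (𝓝[>] 0) :=
    tendsto_nhdsWithin_iff.2 ⟨tendsto_one_div_add_atTop_nhds_zero_nat,
      Eventually.of_forall fun n => by simp only [Set.mem_Ioi]; positivity⟩
  have hm : ∀ᶠ n : ℕ in atTop, t ∈ Metric.closedBall t (1 * (1 / ((n : ℝ) + 1))) :=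
    Eventually.of_forall fun n => Metric.mem_closedBall_self (by positivity)
  have hle := le_of_tendsto_of_tendsto' (ht1 (fun _ => t) _ hδ hm)
    ((ht2 (fun _ => t) _ hδ hm).const_mul (‖X‖ ^ 2)) (fun n => by
      simp only [setAverage_eq, Real.closedBall_eq_Icc, smul_eq_mul]
      rw [mul_left_comm]
      exact mul_le_mul_of_nonneg_left (key _ _) (by positivity))
  rw [← mul_pow] at hle
  exact (pow_le_pow_iff_left₀ (norm_nonneg _) (by positivity) two_ne_zero).1 hle

/-- Operators of simple type commute with multiplication by scalar functions. -/
theorem apply_ae_eq_smul (hX : IsSimpleType X) {f g : L2R H} {φ : ℝ → ℂ}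
    (h : ∀ᵐ t : ℝ, g t = φ t • f t) : ∀ᵐ t : ℝ, X g t = φ t • X f t := by
  -- The constant must eventually depend on `t`. A countable dense set of constants keeps the
  -- exceptional set null; continuity in `c` then permits `c = φ t`, where the right side is zero.
  have hc : ∀ᵐ t : ℝ, ∀ n : ℕ,
      ‖X g t - TopologicalSpace.denseSeq ℂ n • X f t‖ ≤
        ‖X‖ * ‖(φ t - TopologicalSpace.denseSeq ℂ n) • f t‖ := by
    rw [ae_all_iff]
    intro n
    set c := TopologicalSpace.denseSeq ℂ n
    filter_upwards [hX.norm_apply_ae_le (g - c • f), h, Lp.coeFn_sub g (c • f),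
      Lp.coeFn_smul c f, Lp.coeFn_sub (X g) (c • X f), Lp.coeFn_smul c (X f)]
      with t h1 h2 h3 h4 h5 h6
    rw [map_sub, map_smul, h5, Pi.sub_apply, h6, h3, Pi.sub_apply, h4, h2] at h1
    simpa [sub_smul] using h1
  filter_upwards [hc] with t ht
  have hcl : ∀ c : ℂ, ‖X g t - c • X f t‖ ≤ ‖X‖ * ‖(φ t - c) • f t‖ := by
    intro c
    refine (TopologicalSpace.denseRange_denseSeq ℂ).induction_on
      (p := fun c => ‖X g t - c • X f t‖ ≤ ‖X‖ * ‖(φ t - c) • f t‖) c ?_ ht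
    exact isClosed_le (by fun_prop) (by fun_prop)
  have := hcl (φ t)
  simpa [sub_eq_zero] using this

end IsSimpleType

/-! ### Shifting horizontal lines of integration -/

section Contour

variable {E : Type*} [NormedAddCommGroup E] [NormedSpace ℂ E] {g : ℂ → E}

/-- Clamping the height at `a` makes the integrand continuous on the whole plane, as Tonelli's
theorem will need, and changes nothing for heights above `a`. -/
theorem continuous_slice_max (hg : DifferentiableOn ℂ g UpperHalfPlane.upperHalfPlaneSet)
    {a : ℝ} (ha : 0 < a) :
    Continuous fun p : ℝ × ℝ => slice g (max p.2 a) p.1 := by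
  refine hg.continuousOn.comp_continuous (by fun_prop) fun p => ?_
  simp [ha]

/-- Cauchy's theorem on the rectangle with corners `-T + ia` and `T + ib`: the difference of the
horizontal sides is that of the vertical ones. -/
theorem enorm_intervalIntegral_slice_sub_le
    (hg : DifferentiableOn ℂ g UpperHalfPlane.upperHalfPlaneSet)
    {a b : ℝ} (ha : 0 < a) (hab : a ≤ b) (T : ℝ) :
    ‖(∫ x in (-T)..T, slice g a x) - ∫ x in (-T)..T, slice g b x‖ₑ ≤
      (∫⁻ y in Set.Ioc a b, ‖slice g (max y a) T‖ₑ) +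
        ∫⁻ y in Set.Ioc a b, ‖slice g (max y a) (-T)‖ₑ := by
  have hrect := Complex.integral_boundary_rect_eq_zero_of_differentiableOn g
    (⟨-T, a⟩ : ℂ) (⟨T, b⟩ : ℂ) (hg.mono fun z hz => by
      have := hz.2
      simp only [Set.mem_preimage, Set.uIcc_of_le hab] at this
      exact ha.trans_le this.1)
  have hside : ∀ x : ℝ, ‖∫ y : ℝ in a..b, g ((x : ℂ) + y * Complex.I)‖ₑ ≤
      ∫⁻ y in Set.Ioc a b, ‖slice g (max y a) x‖ₑ := by
    intro x
    rw [intervalIntegral.integral_of_le hab]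
    refine (enorm_integral_le_lintegral_enorm _).trans (le_of_eq ?_)
    refine setLIntegral_congr_fun measurableSet_Ioc fun y hy => ?_
    simp only [slice, max_eq_left hy.1.le]
  simp only at hrect
  have heq : (∫ x in (-T)..T, slice g a x) - ∫ x in (-T)..T, slice g b x =
      Complex.I • (∫ y : ℝ in a..b, g (((-T : ℝ) : ℂ) + y * Complex.I)) -
        Complex.I • ∫ y : ℝ in a..b, g ((T : ℂ) + y * Complex.I) := by
    simp only [slice]
    rw [← sub_eq_zero, ← hrect]
    abel
  rw [heq, add_comm]
  refine enorm_sub_le.trans (add_le_add ?_ ?_)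
  · rw [enorm_smul]
    simpa [← ofReal_norm] using hside (-T)
  · rw [enorm_smul]
    simpa [← ofReal_norm] using hside T

/-- The integral of an analytic function over horizontal lines does not depend on the height,
if these integrals are absolutely and uniformly convergent. -/
theorem integral_slice_eq (hg : DifferentiableOn ℂ g UpperHalfPlane.upperHalfPlaneSet)
    {C : ℝ≥0} (hC : ∀ y : ℝ, 0 < y → eLpNorm (slice g y) 1 volume ≤ C)
    {a b : ℝ} (ha : 0 < a) (hab : a ≤ b) : ∫ x, slice g a x = ∫ x, slice g b x := by
  have hint : ∀ y : ℝ, 0 < y → Integrable (slice g y) := fun y hy => by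
    have hc : Continuous (slice g y) := by
      refine hg.continuousOn.comp_continuous (by fun_prop) fun x => ?_
      simpa using hy
    exact memLp_one_iff_integrable.1 ⟨hc.aestronglyMeasurable, (hC y hy).trans_lt (by simp)⟩
  set V : ℝ → ℝ≥0∞ := fun x => ∫⁻ y in Set.Ioc a b, ‖slice g (max y a) x‖ₑ with hV
  have hcont := (continuous_slice_max hg ha).enorm.measurable
  have hVm : Measurable V := hcont.lintegral_prod_right'
  have hVfin : ∫⁻ x, V x < ∞ := by
    rw [hV, lintegral_lintegral_swap hcont.aemeasurable]
    calc ∫⁻ y in Set.Ioc a b, ∫⁻ x, ‖slice g (max y a) x‖ₑ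
        ≤ ∫⁻ _ in Set.Ioc a b, (C : ℝ≥0∞) := by
          refine lintegral_mono fun y => ?_
          rw [← eLpNorm_one_eq_lintegral_enorm]
          exact hC _ (lt_max_of_lt_right ha)
      _ < ∞ := by
          rw [setLIntegral_const]
          exact ENNReal.mul_lt_top (by simp) (by simp)
  -- No pointwise decay of the vertical sides is available, only integrability of `V`. A nonzero
  -- difference would force `V T + V (-T) ≥ c > 0` for all large `T`, contradicting it.
  by_contra hne
  set D := (∫ x, slice g a x) - ∫ x, slice g b x with hD
  have hD0 : 0 < ‖D‖ₑ := by
    rw [enorm_pos]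
    exact sub_ne_zero.2 hne
  have hlim : Tendsto (fun T : ℝ =>
      ‖(∫ x in (-T)..T, slice g a x) - ∫ x in (-T)..T, slice g b x‖ₑ) atTop (𝓝 ‖D‖ₑ) :=
    ((intervalIntegral_tendsto_integral (hint a ha) tendsto_neg_atTop_atBot tendsto_id).sub
      (intervalIntegral_tendsto_integral (hint b (ha.trans_le hab)) tendsto_neg_atTop_atBot
        tendsto_id)).enorm
  obtain ⟨c, hc0, hcD⟩ := exists_between hD0
  obtain ⟨T₀, hT₀⟩ := eventually_atTop.1 (hlim.eventually_const_lt hcD)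
  have hlow : ∫⁻ _ in Set.Ici T₀, c ≤ (∫⁻ x, V x) + ∫⁻ x, V x := by
    calc ∫⁻ _ in Set.Ici T₀, c ≤ ∫⁻ x in Set.Ici T₀, (V x + V (-x)) :=
          setLIntegral_mono' measurableSet_Ici fun T hT =>
            (hT₀ T hT).le.trans (enorm_intervalIntegral_slice_sub_le hg ha hab T)
      _ ≤ ∫⁻ x, (V x + V (-x)) := setLIntegral_le_lintegral _ _
      _ = (∫⁻ x, V x) + ∫⁻ x, V x := by
          rw [lintegral_add_left hVm, lintegral_neg_eq_self]
  rw [setLIntegral_const, Real.volume_Ici, ENNReal.mul_top hc0.ne'] at hlow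
  exact absurd hlow (not_le.2 (ENNReal.add_lt_top.2 ⟨hVfin, hVfin⟩))

end Contour

/-! ### Estimates for the Cauchy kernel on the line -/

section Kernel

theorem norm_inv_ofReal_sub_sq (c : ℂ) (t : ℝ) :
    ‖((t : ℂ) - c)⁻¹‖ ^ 2 = ((t - c.re) ^ 2 + c.im ^ 2)⁻¹ := by
  rw [norm_inv, inv_pow, ← Complex.normSq_eq_norm_sq, Complex.normSq_apply]
  congr 1
  simp
  ring

theorem norm_inv_ofReal_sub_sq_eq_cauchyPDFReal {c : ℂ} (hc : c.im ≠ 0) (t : ℝ) :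
    ‖((t : ℂ) - c)⁻¹‖ ^ 2 =
      (Real.pi / |c.im|) * ProbabilityTheory.cauchyPDFReal c.re ‖c.im‖₊ t := by
  have : |c.im| ≠ 0 := abs_ne_zero.2 hc
  rw [norm_inv_ofReal_sub_sq, ProbabilityTheory.cauchyPDFReal_def, coe_nnnorm, Real.norm_eq_abs,
    sq_abs]
  field_simp

theorem integral_norm_inv_ofReal_sub_sq {c : ℂ} (hc : c.im ≠ 0) :
    ∫ t : ℝ, ‖((t : ℂ) - c)⁻¹‖ ^ 2 = Real.pi / |c.im| := by
  simp_rw [norm_inv_ofReal_sub_sq_eq_cauchyPDFReal hc]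
  rw [integral_const_mul, ProbabilityTheory.integral_cauchyPDFReal_eq_one _ (by simpa using hc),
    mul_one]

theorem ofReal_sub_ne_zero {c : ℂ} (hc : c.im ≠ 0) (t : ℝ) : (t : ℂ) - c ≠ 0 := by
  intro h
  have := congrArg Complex.im h
  simp at this
  exact hc this

theorem continuous_inv_ofReal_sub {c : ℂ} (hc : c.im ≠ 0) :
    Continuous fun t : ℝ => ((t : ℂ) - c)⁻¹ :=
  Continuous.inv₀ (by fun_prop) (ofReal_sub_ne_zero hc)

theorem memLp_inv_ofReal_sub {c : ℂ} (hc : c.im ≠ 0) :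
    MemLp (fun t : ℝ => ((t : ℂ) - c)⁻¹) 2 volume := by
  rw [memLp_two_iff_integrable_sq_norm (continuous_inv_ofReal_sub hc).aestronglyMeasurable]
  simp_rw [norm_inv_ofReal_sub_sq_eq_cauchyPDFReal hc]
  exact (ProbabilityTheory.integrable_cauchyPDFReal _).const_mul _

theorem eLpNorm_inv_ofReal_sub_sq {c : ℂ} (hc : c.im ≠ 0) :
    eLpNorm (fun t : ℝ => ((t : ℂ) - c)⁻¹) 2 volume ^ 2 = ENNReal.ofReal (Real.pi / |c.im|) := by
  rw [← ofReal_integral_norm_sq (memLp_inv_ofReal_sub hc), integral_norm_inv_ofReal_sub_sq hc]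

/-- Moving upwards, away from the pole `c` in the lower half plane, decreases the kernel. -/
theorem norm_inv_slice_sub_le {c : ℂ} (hc : c.im < 0) {y : ℝ} (hy : 0 ≤ y) (t : ℝ) :
    ‖((t : ℂ) + y * Complex.I - c)⁻¹‖ ≤ ‖((t : ℂ) - c)⁻¹‖ := by
  have h : (t : ℂ) + y * Complex.I - c = (t : ℂ) - (c - y * Complex.I) := by ring
  rw [h, ← pow_le_pow_iff_left₀ (norm_nonneg _) (norm_nonneg _) two_ne_zero,
    norm_inv_ofReal_sub_sq, norm_inv_ofReal_sub_sq]
  simp only [Complex.sub_re, Complex.mul_re, Complex.ofReal_re, Complex.I_re, Complex.ofReal_im,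
    Complex.I_im, Complex.sub_im, Complex.mul_im, mul_zero, mul_one, add_zero, sub_zero]
  have : 0 < c.im ^ 2 := by nlinarith
  gcongr (?_ + ?_)⁻¹
  · exact le_rfl
  · nlinarith

/-- Resolvent identity, with one factor bounded by `|c.im|⁻¹`. -/
theorem norm_inv_slice_sub_sub_le {c : ℂ} (hc : c.im < 0) {y : ℝ} (hy : 0 ≤ y) (t : ℝ) :
    ‖((t : ℂ) + y * Complex.I - c)⁻¹ - ((t : ℂ) - c)⁻¹‖ ≤ y / |c.im| * ‖((t : ℂ) - c)⁻¹‖ := by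
  have h0 := ofReal_sub_ne_zero hc.ne t
  have h1 : (t : ℂ) + y * Complex.I - c ≠ 0 := by
    have := ofReal_sub_ne_zero (c := c - y * Complex.I) (by simp; linarith) t
    convert this using 1
    ring
  have h2 : ((t : ℂ) + y * Complex.I - c)⁻¹ - ((t : ℂ) - c)⁻¹ =
      -(y * Complex.I) * (((t : ℂ) + y * Complex.I - c)⁻¹ * ((t : ℂ) - c)⁻¹) := by
    field_simp
    ring
  have h3 : ‖((t : ℂ) - c)⁻¹‖ ≤ |c.im|⁻¹ := by
    rw [norm_inv]
    refine inv_anti₀ (abs_pos.2 hc.ne) ?_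
    simpa using Complex.abs_im_le_norm ((t : ℂ) - c)
  rw [h2, norm_mul, norm_mul, norm_neg, norm_mul, Complex.norm_I, mul_one, Complex.norm_real,
    Real.norm_of_nonneg hy, div_eq_mul_inv, mul_assoc]
  gcongr
  exact (norm_inv_slice_sub_le hc hy t).trans h3

end Kernel

/-! ### Cauchy integrals of boundary values in the lower half plane -/

section Vanishing

variable {H : Type*} [NormedAddCommGroup H] [NormedSpace ℂ H]

theorem tendsto_eLpNorm_inv_slice_sub {c : ℂ} (hc : c.im < 0) :
    Tendsto (fun y : ℝ => eLpNorm
      (fun t : ℝ => ((t : ℂ) + y * Complex.I - c)⁻¹ - ((t : ℂ) - c)⁻¹) 2 volume)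
      (𝓝[>] 0) (𝓝 0) := by
  set A := eLpNorm (fun t : ℝ => ((t : ℂ) - c)⁻¹) 2 volume with hA
  have hA' : A ≠ ∞ := (memLp_inv_ofReal_sub hc.ne).eLpNorm_ne_top
  have h1 : Tendsto (fun y : ℝ => ENNReal.ofReal (y / |c.im|) * A) (𝓝[>] 0) (𝓝 0) := by
    have : Tendsto (fun y : ℝ => ENNReal.ofReal (y / |c.im|)) (𝓝[>] 0) (𝓝 0) := by
      have hc' : Continuous fun y : ℝ => ENNReal.ofReal (y / |c.im|) :=
        ENNReal.continuous_ofReal.comp (by fun_prop)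
      simpa using (hc'.tendsto 0).mono_left nhdsWithin_le_nhds
    simpa using ENNReal.Tendsto.mul_const this (Or.inr hA')
  refine tendsto_of_tendsto_of_tendsto_of_le_of_le' tendsto_const_nhds h1
    (Eventually.of_forall fun _ => zero_le) ?_
  filter_upwards [self_mem_nhdsWithin] with y hy
  exact eLpNorm_le_mul_eLpNorm_of_ae_le_mul
    (Eventually.of_forall fun t => norm_inv_slice_sub_sub_le hc (le_of_lt hy) t) 2

/-- The Cauchy integral of a boundary value function vanishes in the lower half plane. -/
theorem IsHardyExtension.integral_inv_sub_smul_eq_zero {F : ℂ → H} {f : L2R H}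
    (hF : IsHardyExtension F f) {c : ℂ} (hc : c.im < 0) :
    ∫ t : ℝ, ((t : ℂ) - c)⁻¹ • f t = 0 := by
  obtain ⟨C, hC⟩ := hF.hardy.bounded
  have hne : ∀ y : ℝ, 0 < y → (c - y * Complex.I).im < 0 := fun y hy => by
    simp; linarith
  have hker : ∀ y t : ℝ, (t : ℂ) + y * Complex.I - c = (t : ℂ) - (c - y * Complex.I) :=
    fun y t => by ring
  have hkm : ∀ y : ℝ, 0 < y → AEStronglyMeasurable
      (fun t : ℝ => ((t : ℂ) + y * Complex.I - c)⁻¹) volume := fun y hy => by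
    simp_rw [hker y]
    exact (continuous_inv_ofReal_sub (hne y hy).ne).aestronglyMeasurable
  set g : ℂ → H := fun z => (z - c)⁻¹ • F z with hg
  have hgs : ∀ y, slice g y = (fun t : ℝ => ((t : ℂ) + y * Complex.I - c)⁻¹) • slice F y :=
    fun y => rfl
  have hgd : DifferentiableOn ℂ g UpperHalfPlane.upperHalfPlaneSet := by
    refine DifferentiableOn.smul (DifferentiableOn.inv (by fun_prop) fun z hz h => ?_)
      hF.hardy.analytic
    have := congrArg Complex.im h
    have hz' : 0 < z.im := hz
    simp at this
    linarith
  have hg1 : ∀ y : ℝ, 0 < y → eLpNorm (slice g y) 1 volume ≤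
      eLpNorm (fun t : ℝ => ((t : ℂ) + y * Complex.I - c)⁻¹) 2 volume * C := fun y hy => by
    rw [hgs]
    exact (eLpNorm_smul_le_mul_eLpNorm (hF.hardy.aestronglyMeasurable_slice hy)
      (hkm y hy)).trans (mul_le_mul_right (hC y hy) _)
  set A := eLpNorm (fun t : ℝ => ((t : ℂ) - c)⁻¹) 2 volume with hA
  have hA' : A ≠ ∞ := (memLp_inv_ofReal_sub hc.ne).eLpNorm_ne_top
  have hkA : ∀ y : ℝ, 0 < y →
      eLpNorm (fun t : ℝ => ((t : ℂ) + y * Complex.I - c)⁻¹) 2 volume ≤ A :=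
    fun y hy => eLpNorm_mono fun t => norm_inv_slice_sub_le hc hy.le t
  have hbd : ∀ y : ℝ, 0 < y → eLpNorm (slice g y) 1 volume ≤ ((A.toNNReal * C : ℝ≥0) : ℝ≥0∞) :=
    fun y hy => (hg1 y hy).trans (by
      rw [ENNReal.coe_mul, ENNReal.coe_toNNReal hA']
      exact mul_le_mul_left (hkA y hy) _)
  have hconst : ∀ y : ℝ, 0 < y → ∫ t, slice g y t = ∫ t, slice g 1 t := fun y hy => by
    rcases le_total y 1 with h | h
    · exact integral_slice_eq hgd hbd hy h
    · exact (integral_slice_eq hgd hbd one_pos h).symm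
  -- The integral is independent of the height, and by Cauchy–Schwarz its square is at most `(π / y)
  -- * C ^ 2`, which tends to zero as `y → ∞`.
  have hzero : ∫ t, slice g 1 t = 0 := by
    have hle : ∀ y : ℝ, 0 < y →
        ‖∫ t, slice g 1 t‖ₑ ^ 2 ≤ ENNReal.ofReal (Real.pi / y) * (C : ℝ≥0∞) ^ 2 := by
      intro y hy
      rw [← hconst y hy]
      have h1 : ‖∫ t, slice g y t‖ₑ ≤
          eLpNorm (fun t : ℝ => ((t : ℂ) + y * Complex.I - c)⁻¹) 2 volume * C :=
        (enorm_integral_le_lintegral_enorm _).trans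
          ((eLpNorm_one_eq_lintegral_enorm (f := slice g y)).symm.le.trans (hg1 y hy))
      refine (pow_le_pow_left' h1 2).trans ?_
      rw [mul_pow]
      refine mul_le_mul_left ?_ _
      simp_rw [hker y]
      rw [eLpNorm_inv_ofReal_sub_sq (hne y hy).ne]
      refine ENNReal.ofReal_le_ofReal (div_le_div_of_nonneg_left Real.pi_pos.le hy ?_)
      rw [abs_of_neg (hne y hy)]
      simp
      linarith
    have hlim : Tendsto (fun y : ℝ => ENNReal.ofReal (Real.pi / y) * (C : ℝ≥0∞) ^ 2)
        atTop (𝓝 0) := by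
      have h1 : Tendsto (fun y : ℝ => ENNReal.ofReal (Real.pi / y)) atTop (𝓝 0) := by
        simpa using ENNReal.tendsto_ofReal (tendsto_const_nhds.div_atTop tendsto_id)
      simpa using ENNReal.Tendsto.mul_const h1 (Or.inr (by simp))
    have := ge_of_tendsto hlim ((eventually_gt_atTop 0).mono hle)
    simpa using this
  -- As `y ↓ 0`, both the kernel and the slice of `F` converge in `L₂`, so their product converges
  -- in `L₁`.
  have hlim : Tendsto (fun y : ℝ => ∫ t, slice g y t) (𝓝[>] 0)
      (𝓝 (∫ t : ℝ, ((t : ℂ) - c)⁻¹ • f t)) := by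
    refine tendsto_integral_of_L1' _ ?_ ?_ ?_
    · exact (continuous_inv_ofReal_sub hc.ne).aestronglyMeasurable.smul
        (Lp.aestronglyMeasurable f)
    · filter_upwards [self_mem_nhdsWithin] with y hy
      refine memLp_one_iff_integrable.1 ⟨?_, (hbd y hy).trans_lt ENNReal.coe_lt_top⟩
      exact (hkm y hy).smul (hF.hardy.aestronglyMeasurable_slice hy)
    · have h1 := ENNReal.Tendsto.const_mul hF.boundary (Or.inr hA')
      have h2 := ENNReal.Tendsto.mul_const (tendsto_eLpNorm_inv_slice_sub hc)
        (Or.inr (Lp.memLp f).eLpNorm_ne_top)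
      have h3 := h1.add h2
      rw [mul_zero, zero_mul, add_zero] at h3
      refine tendsto_of_tendsto_of_tendsto_of_le_of_le' tendsto_const_nhds h3
        (Eventually.of_forall fun _ => zero_le) ?_
      filter_upwards [self_mem_nhdsWithin] with y hy
      have hdec : (slice g y - fun t : ℝ => ((t : ℂ) - c)⁻¹ • f t) =
          (fun t : ℝ => ((t : ℂ) + y * Complex.I - c)⁻¹) • (fun t => slice F y t - f t) +
          (fun t : ℝ => ((t : ℂ) + y * Complex.I - c)⁻¹ - ((t : ℂ) - c)⁻¹) • (f : ℝ → H) := by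
        funext t
        simp only [hgs, Pi.sub_apply, Pi.add_apply, Pi.smul_apply', smul_sub, sub_smul]
        abel
      have hm1 := (hF.hardy.aestronglyMeasurable_slice hy).sub (Lp.aestronglyMeasurable f)
      have hm2 := (hkm y hy).sub (continuous_inv_ofReal_sub hc.ne).aestronglyMeasurable
      rw [hdec]
      refine (eLpNorm_add_le ((hkm y hy).smul hm1) (hm2.smul (Lp.aestronglyMeasurable f))
        le_rfl).trans (add_le_add ?_ ?_)
      · exact (eLpNorm_smul_le_mul_eLpNorm hm1 (hkm y hy)).trans
          (mul_le_mul_left (hkA y hy) _)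
      · exact eLpNorm_smul_le_mul_eLpNorm (Lp.aestronglyMeasurable f) hm2
  have hlim0 : Tendsto (fun y : ℝ => ∫ t, slice g y t) (𝓝[>] 0) (𝓝 0) := by
    refine tendsto_const_nhds.congr' ?_
    filter_upwards [self_mem_nhdsWithin] with y hy
    rw [hconst y hy, hzero]
  exact tendsto_nhds_unique hlim hlim0

end Vanishing

/-! ### Cauchy kernels as Hardy functions, and division by a zero -/

section

variable {H : Type*} [NormedAddCommGroup H] [NormedSpace ℂ H]

theorem memLp_inv_ofReal_sub_smul {c : ℂ} (hc : c.im ≠ 0) (h : H) :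
    MemLp (fun t : ℝ => ((t : ℂ) - c)⁻¹ • h) 2 volume := by
  refine (memLp_inv_ofReal_sub hc).of_le_mul (c := ‖h‖)
    ((continuous_inv_ofReal_sub hc).smul continuous_const).aestronglyMeasurable
    (Eventually.of_forall fun t => ?_)
  rw [norm_smul, mul_comm]

/-- The function `t ↦ (t - c)⁻¹ h` in `L₂(ℝ) ⊗ H`, as a linear function of `h`. -/
noncomputable def cauchyKernel (H : Type*) [NormedAddCommGroup H] [NormedSpace ℂ H]
    {c : ℂ} (hc : c.im ≠ 0) : H →ₗ[ℂ] L2R H where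
  toFun h := (memLp_inv_ofReal_sub_smul hc h).toLp
  map_add' h k := by
    rw [← MemLp.toLp_add]
    congr 1
    funext t
    simp
  map_smul' a h := by
    rw [RingHom.id_apply, ← MemLp.toLp_const_smul]
    congr 1
    funext t
    simp [smul_comm a]

theorem coeFn_cauchyKernel {c : ℂ} (hc : c.im ≠ 0) (h : H) :
    ∀ᵐ t : ℝ, cauchyKernel H hc h t = ((t : ℂ) - c)⁻¹ • h :=
  (memLp_inv_ofReal_sub_smul hc h).coeFn_toLp

theorem sub_ne_zero_of_im_pos {c z : ℂ} (hc : c.im < 0) (hz : 0 < z.im) : z - c ≠ 0 := by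
  intro h
  have := congrArg Complex.im h
  simp at this
  linarith

theorem isHardyExtension_cauchyKernel {c : ℂ} (hc : c.im < 0) (h : H) :
    IsHardyExtension (fun z => (z - c)⁻¹ • h) (cauchyKernel H hc.ne h) := by
  refine ⟨⟨?_, ?_⟩, ?_⟩
  · exact DifferentiableOn.smul_const
      (DifferentiableOn.inv (by fun_prop) fun z hz => sub_ne_zero_of_im_pos hc hz) h
  · refine ⟨(eLpNorm (fun t : ℝ => ((t : ℂ) - c)⁻¹ • h) 2 volume).toNNReal, fun y hy => ?_⟩
    rw [ENNReal.coe_toNNReal (memLp_inv_ofReal_sub_smul hc.ne h).eLpNorm_ne_top]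
    refine eLpNorm_mono fun t => ?_
    simp only [slice, norm_smul]
    exact mul_le_mul_of_nonneg_right (norm_inv_slice_sub_le hc hy.le t) (norm_nonneg _)
  · have h1 := ENNReal.Tendsto.mul_const (b := ENNReal.ofReal ‖h‖)
      (tendsto_eLpNorm_inv_slice_sub hc) (Or.inr ENNReal.ofReal_ne_top)
    rw [zero_mul] at h1
    refine tendsto_of_tendsto_of_tendsto_of_le_of_le tendsto_const_nhds h1
      (fun _ => zero_le) fun y => ?_
    dsimp only
    rw [mul_comm]
    refine eLpNorm_le_mul_eLpNorm_of_ae_le_mul ?_ 2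
    filter_upwards [coeFn_cauchyKernel hc.ne h] with t ht
    rw [ht, slice, ← sub_smul, norm_smul, mul_comm]

variable {F : ℂ → H} {f : L2R H}

/-- Lines at height at most `w.im / 2` stay at distance at least `w.im / 2` from the pole. -/
theorem norm_inv_slice_sub_pole_le {w : ℂ} (hw : 0 < w.im) {y : ℝ} (hy : y ≤ w.im / 2) (t : ℝ) :
    ‖((t : ℂ) + y * Complex.I - w)⁻¹‖ ≤ (w.im / 2)⁻¹ := by
  rw [norm_inv]
  refine inv_anti₀ (by positivity) (le_trans ?_ (Complex.abs_im_le_norm _))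
  simp only [Complex.sub_im, Complex.add_im, Complex.ofReal_im, Complex.mul_im, Complex.ofReal_re,
    Complex.I_im, Complex.I_re]
  rw [le_abs]
  right
  linarith

theorem norm_inv_slice_sub_pole_sub_le {w : ℂ} (hw : 0 < w.im) {y : ℝ} (hy0 : 0 ≤ y)
    (hy : y ≤ w.im / 2) (t : ℝ) :
    ‖((t : ℂ) + y * Complex.I - w)⁻¹ - ((t : ℂ) - w)⁻¹‖ ≤ y * ((w.im / 2)⁻¹ * (w.im / 2)⁻¹) := by
  have h0 := ofReal_sub_ne_zero hw.ne' t
  have h1 : (t : ℂ) + y * Complex.I - w ≠ 0 := by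
    have := ofReal_sub_ne_zero (c := w - y * Complex.I) (by simp; linarith) t
    convert this using 1
    ring
  have h2 : ((t : ℂ) + y * Complex.I - w)⁻¹ - ((t : ℂ) - w)⁻¹ =
      -(y * Complex.I) * (((t : ℂ) + y * Complex.I - w)⁻¹ * ((t : ℂ) - w)⁻¹) := by
    field_simp
    ring
  rw [h2, norm_mul, norm_mul, norm_neg, norm_mul, Complex.norm_I, mul_one, Complex.norm_real,
    Real.norm_of_nonneg hy0]
  gcongr
  · exact norm_inv_slice_sub_pole_le hw hy t
  · simpa using norm_inv_slice_sub_pole_le hw (y := 0) (by positivity) t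

theorem memLp_inv_sub_smul {w : ℂ} (hw : 0 < w.im) (f : L2R H) :
    MemLp (fun t : ℝ => ((t : ℂ) - w)⁻¹ • f t) 2 volume := by
  refine (Lp.memLp f).of_le_mul (c := (w.im / 2)⁻¹)
    ((continuous_inv_ofReal_sub hw.ne').aestronglyMeasurable.smul (Lp.aestronglyMeasurable f))
    (Eventually.of_forall fun t => ?_)
  rw [norm_smul]
  gcongr
  simpa using norm_inv_slice_sub_pole_le hw (y := 0) (by positivity) t

/-- Dividing a function of the Hardy space by `z - w` at a zero `w`, values of the quotient are
controlled by those of the function and of a Cauchy kernel. -/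
theorem exists_norm_dslope_le [CompleteSpace H]
    (hF : DifferentiableOn ℂ F UpperHalfPlane.upperHalfPlaneSet)
    {w : ℂ} (hw : 0 < w.im) (hFw : F w = 0) :
    ∃ A B : ℝ, 0 ≤ A ∧ 0 ≤ B ∧ ∀ z : ℂ, 0 < z.im →
      ‖dslope F w z‖ ≤ A * ‖F z‖ + B * ‖(z - (starRingEnd ℂ) w)⁻¹‖ := by
  have hd : DifferentiableOn ℂ (dslope F w) UpperHalfPlane.upperHalfPlaneSet :=
    (Complex.differentiableOn_dslope
      (UpperHalfPlane.isOpen_upperHalfPlaneSet.mem_nhds (show w ∈ _ from hw))).2 hF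
  have hball : Metric.closedBall w (w.im / 2) ⊆ UpperHalfPlane.upperHalfPlaneSet := by
    intro z hz
    have h1 := (Complex.abs_im_le_norm (z - w)).trans (mem_closedBall_iff_norm.1 hz)
    rw [Complex.sub_im, abs_le] at h1
    show 0 < z.im
    linarith
  obtain ⟨M, hM⟩ := (isCompact_closedBall w (w.im / 2)).exists_bound_of_continuousOn
    (hd.continuousOn.mono hball)
  have hM0 : 0 ≤ M := (norm_nonneg _).trans (hM w (Metric.mem_closedBall_self (by positivity)))
  -- Outside the ball, `‖z - w‖ > w.im / 2` gives the first constant. Inside, the quotient is at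
  -- most `M`, and `‖z - conj w‖ ≤ w.im / 2 + 2 * w.im ≤ 3 * w.im` lets the kernel absorb `M`.
  refine ⟨(w.im / 2)⁻¹, M * (3 * w.im), by positivity, by positivity, fun z hz => ?_⟩
  by_cases hzb : z ∈ Metric.closedBall w (w.im / 2)
  · have hne : z - (starRingEnd ℂ) w ≠ 0 := sub_ne_zero_of_im_pos (by simpa using hw) hz
    have h1 : ‖z - (starRingEnd ℂ) w‖ ≤ 3 * w.im := by
      have h2 : z - (starRingEnd ℂ) w = (z - w) + (w - (starRingEnd ℂ) w) := by ring
      have h3 : ‖w - (starRingEnd ℂ) w‖ = 2 * w.im := by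
        rw [Complex.sub_conj]
        simp [abs_of_pos hw]
      have h4 := mem_closedBall_iff_norm.1 hzb
      rw [h2]
      refine (norm_add_le _ _).trans ?_
      linarith
    have h2 : 1 ≤ 3 * w.im * ‖(z - (starRingEnd ℂ) w)⁻¹‖ := by
      rw [norm_inv, ← div_eq_mul_inv]
      exact (one_le_div (norm_pos_iff.2 hne)).2 h1
    calc ‖dslope F w z‖ ≤ M := hM z hzb
      _ ≤ M * (3 * w.im * ‖(z - (starRingEnd ℂ) w)⁻¹‖) := le_mul_of_one_le_right hM0 h2
      _ ≤ _ := by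
        rw [← mul_assoc]
        exact le_add_of_nonneg_left (by positivity)
  · rw [mem_closedBall_iff_norm, not_le] at hzb
    have hzw : z ≠ w := by
      rintro rfl
      simp at hzb
      linarith
    rw [dslope_of_ne _ hzw, slope_def_module, hFw, sub_zero, norm_smul, norm_inv]
    refine le_add_of_le_of_nonneg ?_ (by positivity)
    gcongr

/-- Division by `z - w` of a function of the Hardy space vanishing at `w`. -/
theorem IsHardyExtension.dslope [CompleteSpace H] (hF : IsHardyExtension F f)
    {w : ℂ} (hw : 0 < w.im) (hFw : F w = 0) {d : L2R H}
    (hdf : ∀ᵐ t : ℝ, d t = ((t : ℂ) - w)⁻¹ • f t) : IsHardyExtension (dslope F w) d := by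
  have hd : DifferentiableOn ℂ (_root_.dslope F w) UpperHalfPlane.upperHalfPlaneSet :=
    (Complex.differentiableOn_dslope
      (UpperHalfPlane.isOpen_upperHalfPlaneSet.mem_nhds (show w ∈ _ from hw))).2 hF.hardy.analytic
  obtain ⟨C, hC⟩ := hF.hardy.bounded
  refine ⟨⟨hd, ?_⟩, ?_⟩
  · obtain ⟨A, B, hA, hB, hAB⟩ := exists_norm_dslope_le hF.hardy.analytic hw hFw
    have hcw : ((starRingEnd ℂ) w).im < 0 := by simpa using hw
    set D := eLpNorm (fun t : ℝ => ((t : ℂ) - (starRingEnd ℂ) w)⁻¹) 2 volume with hD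
    have hD' : D ≠ ∞ := (memLp_inv_ofReal_sub hcw.ne).eLpNorm_ne_top
    refine ⟨A.toNNReal * C + B.toNNReal * D.toNNReal, fun y hy => ?_⟩
    have hm1 : AEStronglyMeasurable (fun t => A * ‖slice F y t‖) volume :=
      (hF.hardy.aestronglyMeasurable_slice hy).norm.const_mul A
    have hm2 : AEStronglyMeasurable
        (fun t : ℝ => B * ‖((t : ℂ) - (starRingEnd ℂ) w)⁻¹‖) volume :=
      (continuous_inv_ofReal_sub hcw.ne).aestronglyMeasurable.norm.const_mul B
    calc eLpNorm (slice (_root_.dslope F w) y) 2 volume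
        ≤ eLpNorm ((fun t => A * ‖slice F y t‖) +
            fun t : ℝ => B * ‖((t : ℂ) - (starRingEnd ℂ) w)⁻¹‖) 2 volume := by
          refine eLpNorm_mono_real fun t => ?_
          refine (hAB _ (by simpa using hy)).trans ?_
          simp only [Pi.add_apply, slice]
          gcongr
          exact norm_inv_slice_sub_le hcw hy.le t
      _ ≤ _ := eLpNorm_add_le hm1 hm2 (by norm_num)
      _ ≤ ENNReal.ofReal A * C + ENNReal.ofReal B * D := by
          refine add_le_add ?_ ?_
          · refine (eLpNorm_le_mul_eLpNorm_of_ae_le_mul (g := slice F y) (c := A)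
              (Eventually.of_forall fun t => ?_) 2).trans (mul_le_mul_right (hC y hy) _)
            simp [abs_of_nonneg hA]
          · refine eLpNorm_le_mul_eLpNorm_of_ae_le_mul (Eventually.of_forall fun t => ?_) 2
            rw [norm_mul, norm_norm, Real.norm_of_nonneg hB]
      _ = _ := by
          push_cast
          rw [ENNReal.coe_toNNReal hD']
          rfl
  · set r := (w.im / 2)⁻¹ with hr
    have hr0 : 0 ≤ r := by positivity
    have h1 := ENNReal.Tendsto.const_mul (a := ENNReal.ofReal r) hF.boundary
      (Or.inr ENNReal.ofReal_ne_top)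
    have h2 : Tendsto (fun y : ℝ => ENNReal.ofReal (y * (r * r)) * eLpNorm f 2 volume)
        (𝓝[>] 0) (𝓝 0) := by
      have hc : Continuous fun y : ℝ => ENNReal.ofReal (y * (r * r)) :=
        ENNReal.continuous_ofReal.comp (by fun_prop)
      have h3 : Tendsto (fun y : ℝ => ENNReal.ofReal (y * (r * r))) (𝓝[>] 0) (𝓝 0) := by
        simpa using (hc.tendsto 0).mono_left nhdsWithin_le_nhds
      simpa using ENNReal.Tendsto.mul_const h3 (Or.inr (Lp.memLp f).eLpNorm_ne_top)
    have h3 := h1.add h2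
    rw [mul_zero, add_zero] at h3
    refine tendsto_of_tendsto_of_tendsto_of_le_of_le' tendsto_const_nhds h3
      (Eventually.of_forall fun _ => zero_le) ?_
    filter_upwards [Ioo_mem_nhdsGT (show (0 : ℝ) < w.im / 2 by positivity)] with y hy
    have hm : AEStronglyMeasurable (fun t => slice F y t - f t) volume :=
      (hF.hardy.aestronglyMeasurable_slice hy.1).sub (Lp.aestronglyMeasurable f)
    calc eLpNorm (fun t => slice (_root_.dslope F w) y t - d t)
          2 volume
        ≤ eLpNorm ((fun t => r * ‖slice F y t - f t‖) + fun t => y * (r * r) * ‖f t‖)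
            2 volume := by
          refine eLpNorm_mono_ae_real ?_
          filter_upwards [hdf] with t ht
          have hne : (t : ℂ) + y * Complex.I ≠ w := by
            intro h
            have := congrArg Complex.im h
            simp at this
            have := hy.2
            linarith
          have hs : slice (_root_.dslope F w) y t =
              ((t : ℂ) + y * Complex.I - w)⁻¹ • slice F y t := by
            rw [slice, dslope_of_ne _ hne, slope_def_module, hFw, sub_zero, slice]
          have hdec : slice (_root_.dslope F w) y t - d t =
              ((t : ℂ) + y * Complex.I - w)⁻¹ • (slice F y t - f t) +
              (((t : ℂ) + y * Complex.I - w)⁻¹ - ((t : ℂ) - w)⁻¹) • f t := by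
            rw [hs, ht, smul_sub, sub_smul]
            abel
          rw [hdec]
          refine (norm_add_le _ _).trans ?_
          rw [norm_smul, norm_smul]
          simp only [Pi.add_apply]
          gcongr
          · exact norm_inv_slice_sub_pole_le hw hy.2.le t
          · exact norm_inv_slice_sub_pole_sub_le hw hy.1.le hy.2.le t
      _ ≤ _ := eLpNorm_add_le (hm.norm.const_mul _)
            ((Lp.aestronglyMeasurable f).norm.const_mul _) (by norm_num)
      _ ≤ _ := by
          refine add_le_add ?_ ?_
          · refine eLpNorm_le_mul_eLpNorm_of_ae_le_mul (Eventually.of_forall fun t => ?_) 2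
            rw [norm_mul, norm_norm, Real.norm_of_nonneg hr0]
          · refine eLpNorm_le_mul_eLpNorm_of_ae_le_mul (Eventually.of_forall fun t => ?_) 2
            rw [norm_mul, norm_norm, Real.norm_of_nonneg (mul_nonneg hy.1.le (by positivity))]

end

/-! ### From strong analyticity to analyticity in norm -/

section StrongAnalytic

variable {E E' : Type*} [NormedAddCommGroup E] [NormedSpace ℂ E] [NormedAddCommGroup E']
  [NormedSpace ℂ E']

/-- Schwarz lemma: `u` maps the ball into the closed ball of radius `2 * M` about `u c`. -/
theorem norm_dslope_le_of_norm_le {u : ℂ → E'} {c : ℂ} {r M : ℝ}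
    (hu : DifferentiableOn ℂ u (Metric.ball c r)) (hM : ∀ z ∈ Metric.ball c r, ‖u z‖ ≤ M)
    {z : ℂ} (hz : z ∈ Metric.ball c r) : ‖dslope u c z‖ ≤ 2 * M / r := by
  have hr : 0 < r := Metric.pos_of_mem_ball hz
  refine Complex.norm_dslope_le_div_of_mapsTo_ball hu (fun x hx => ?_) hz
  rw [mem_closedBall_iff_norm]
  refine (norm_sub_le _ _).trans ?_
  linarith [hM x hx, hM c (Metric.mem_ball_self hr)]

/-- Second order Taylor estimate for a bounded analytic function. -/
theorem norm_sub_sub_smul_deriv_le [CompleteSpace E'] {u : ℂ → E'} {c : ℂ} {r M : ℝ}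
    (hu : DifferentiableOn ℂ u (Metric.ball c r)) (hM : ∀ z ∈ Metric.ball c r, ‖u z‖ ≤ M)
    {z : ℂ} (hz : z ∈ Metric.ball c r) :
    ‖u z - u c - (z - c) • deriv u c‖ ≤ 2 * (2 * M / r) / r * ‖z - c‖ ^ 2 := by
  have hr : 0 < r := Metric.pos_of_mem_ball hz
  have hd : DifferentiableOn ℂ (dslope u c) (Metric.ball c r) :=
    (Complex.differentiableOn_dslope (Metric.ball_mem_nhds c hr)).2 hu
  -- The remainder is `(z - c) ^ 2` times the second iterated slope, so the Schwarz bound is used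
  -- twice.
  have hb := norm_dslope_le_of_norm_le hd (fun x hx => norm_dslope_le_of_norm_le hu hM hx) hz
  have heq : u z - u c - (z - c) • deriv u c =
      (z - c) • (z - c) • dslope (dslope u c) c z := by
    rw [sub_smul_dslope, smul_sub, sub_smul_dslope, dslope_same]
  rw [heq, norm_smul, norm_smul, ← mul_assoc, ← pow_two, mul_comm]
  gcongr

/-- A bounded, strongly analytic operator valued function is analytic in norm. -/
theorem differentiableOn_of_forall_apply [CompleteSpace E'] {S : ℂ → E →L[ℂ] E'} {U : Set ℂ} (hU : IsOpen U) {C : ℝ}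
    (hC : ∀ z ∈ U, ‖S z‖ ≤ C) (hS : ∀ h : E, DifferentiableOn ℂ (fun z => S z h) U) :
    DifferentiableOn ℂ S U := by
  intro c hc
  obtain ⟨r, hr, hrU⟩ := Metric.isOpen_iff.1 hU c hc
  have hu : ∀ h, DifferentiableOn ℂ (fun z => S z h) (Metric.ball c r) := fun h => (hS h).mono hrU
  have hM : ∀ h, ∀ z ∈ Metric.ball c r, ‖S z h‖ ≤ C * ‖h‖ := fun h z hz =>
    (S z).le_of_opNorm_le (hC z (hrU hz)) h
  have hda : ∀ h, DifferentiableAt ℂ (fun z => S z h) c := fun h =>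
    (hS h).differentiableAt (hU.mem_nhds hc)
  let D : E →L[ℂ] E' := LinearMap.mkContinuous
    { toFun := fun h => deriv (fun z => S z h) c
      map_add' := fun h k => by
        simp only [map_add]
        exact deriv_fun_add (hda h) (hda k)
      map_smul' := fun a h => by
        simp only [map_smul, RingHom.id_apply]
        exact deriv_fun_const_smul a (hda h) } (2 * C / r) (fun h => by
      have := norm_dslope_le_of_norm_le (hu h) (hM h) (Metric.mem_ball_self hr)
      rw [dslope_same] at this
      refine this.trans (le_of_eq ?_)
      ring)
  have hC0 : 0 ≤ C := (norm_nonneg _).trans (hC c hc)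
  have hder : HasDerivAt S D c := by
    rw [hasDerivAt_iff_isLittleO]
    -- The Taylor remainder at `h` is bounded by a constant times `‖h‖ * ‖z - c‖ ^ 2`, hence is
    -- quadratic in operator norm.
    refine Asymptotics.IsBigO.trans_isLittleO ?_
      (Asymptotics.isLittleO_pow_sub_sub c one_lt_two)
    refine Asymptotics.IsBigO.of_bound (2 * (2 * C / r) / r) ?_
    filter_upwards [Metric.ball_mem_nhds c hr] with z hz
    rw [norm_pow, norm_norm]
    refine ContinuousLinearMap.opNorm_le_bound _ (by positivity) fun h => ?_
    refine (norm_sub_sub_smul_deriv_le (hu h) (hM h) hz).trans (le_of_eq ?_)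
    ring
  exact hder.differentiableAt.differentiableWithinAt

end StrongAnalytic

/-! ### The Poisson formula -/

section Poisson

variable {H : Type*} [NormedAddCommGroup H] [NormedSpace ℂ H] {F G : ℂ → H} {f g : L2R H}

theorem IsHardyExtension.sub (hF : IsHardyExtension F f) (hG : IsHardyExtension G g) :
    IsHardyExtension (F - G) (f - g) := by
  have h := hF.add (hG.const_smul (-1))
  rwa [neg_one_smul, neg_one_smul, ← sub_eq_add_neg, ← sub_eq_add_neg] at h

/-- In this factorization of the Poisson kernel the first factor cancels a zero at `w`; the second
is a Cauchy kernel with pole in the lower half plane. -/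
theorem ofReal_norm_inv_sub_sq (w : ℂ) (t : ℝ) :
    ((‖((t : ℂ) - w)⁻¹‖ ^ 2 : ℝ) : ℂ) =
      ((t : ℂ) - w)⁻¹ * ((t : ℂ) - (starRingEnd ℂ) w)⁻¹ := by
  rw [← Complex.normSq_eq_norm_sq, Complex.normSq_eq_conj_mul_self, mul_comm]
  simp

theorem integrable_inv_sub_smul {c : ℂ} (hc : c.im ≠ 0) (f : L2R H) :
    Integrable fun t : ℝ => ((t : ℂ) - c)⁻¹ • f t :=
  memLp_one_iff_integrable.1 ((Lp.memLp f).smul (memLp_inv_ofReal_sub hc))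

theorem IsHardyExtension.exists_eq_sub_smul [CompleteSpace H] (hF : IsHardyExtension F f) {w : ℂ} (hw : 0 < w.im)
    (hFw : F w = 0) :
    ∃ d ∈ hardySpace H, ∀ᵐ t : ℝ, f t = ((t : ℂ) - w) • (d : L2R H) t := by
  set d : L2R H := (memLp_inv_sub_smul hw f).toLp
  have hd : ∀ᵐ t : ℝ, d t = ((t : ℂ) - w)⁻¹ • f t := (memLp_inv_sub_smul hw f).coeFn_toLp
  refine ⟨d, ⟨_, hF.dslope hw hFw hd⟩, ?_⟩
  filter_upwards [hd] with t ht
  rw [ht, smul_smul, mul_inv_cancel₀ (ofReal_sub_ne_zero hw.ne' t), one_smul]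

/-- If a function is divisible by `t - w` in the Hardy space, its Poisson integral vanishes
at `w`. -/
theorem integral_poisson_smul_eq_zero {d : L2R H} (hd : d ∈ hardySpace H) {w : ℂ} (hw : 0 < w.im)
    (h : ∀ᵐ t : ℝ, f t = ((t : ℂ) - w) • d t) :
    ∫ t : ℝ, ((‖((t : ℂ) - w)⁻¹‖ ^ 2 : ℝ) : ℂ) • f t = 0 := by
  obtain ⟨D, hD⟩ := hd
  rw [← hD.integral_inv_sub_smul_eq_zero (c := (starRingEnd ℂ) w) (by simpa using hw)]
  refine integral_congr_ae ?_
  filter_upwards [h] with t ht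
  have := ofReal_sub_ne_zero hw.ne' t
  rw [ht, ofReal_norm_inv_sub_sq, smul_smul]
  congr 1
  field_simp

variable [CompleteSpace H]

/-- The Poisson formula. -/
theorem IsHardyExtension.integral_poisson_smul (hF : IsHardyExtension F f) {w : ℂ}
    (hw : 0 < w.im) :
    ∫ t : ℝ, ((‖((t : ℂ) - w)⁻¹‖ ^ 2 : ℝ) : ℂ) • f t = ((Real.pi / w.im : ℝ) : ℂ) • F w := by
  set c := (starRingEnd ℂ) w with hc
  have hcw : c.im < 0 := by simpa [hc] using hw
  have hwc : w - c ≠ 0 := sub_ne_zero_of_im_pos hcw hw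
  set k := cauchyKernel H hcw.ne (F w) with hk
  have hkext : IsHardyExtension _ k := isHardyExtension_cauchyKernel hcw (F w)
  -- The multiple `(w - c) • k` takes the value `F w` at `w`, so the difference can be divided by `t
  -- - w`.
  have hq := hF.sub (hkext.const_smul (w - c))
  obtain ⟨d, hd, hqd⟩ := hq.exists_eq_sub_smul hw (by
    simp [smul_smul, mul_inv_cancel₀ hwc])
  obtain ⟨D, hD⟩ := hd
  -- By partial fractions, `(w - c) / ((t - w) * (t - c)) = 1 / (t - w) - 1 / (t - c)`. The terms
  -- with `k` and `d` are Cauchy integrals equal to zero; only the total mass of the Poisson kernel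
  -- remains.
  have hpt : ∀ᵐ t : ℝ, ((‖((t : ℂ) - w)⁻¹‖ ^ 2 : ℝ) : ℂ) • f t =
      ((‖((t : ℂ) - w)⁻¹‖ ^ 2 : ℝ) : ℂ) • F w - ((t : ℂ) - c)⁻¹ • k t +
        ((t : ℂ) - c)⁻¹ • d t := by
    filter_upwards [hqd, Lp.coeFn_sub f ((w - c) • k), Lp.coeFn_smul (w - c) k,
      coeFn_cauchyKernel hcw.ne (F w)] with t h1 h2 h3 h4
    rw [h2, Pi.sub_apply, h3, Pi.smul_apply, sub_eq_iff_eq_add] at h1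
    rw [← hk] at h4
    rw [h1, h4, ofReal_norm_inv_sub_sq, ← hc]
    have e1 := ofReal_sub_ne_zero hw.ne' t
    have e2 := ofReal_sub_ne_zero hcw.ne t
    rw [smul_add, add_comm, smul_smul, smul_smul, smul_smul, smul_smul, ← sub_smul]
    congr 2
    · field_simp
      ring
    · field_simp
  rw [integral_congr_ae hpt, integral_add, integral_sub,
    hkext.integral_inv_sub_smul_eq_zero hcw, hD.integral_inv_sub_smul_eq_zero hcw,
    integral_smul_const, integral_complex_ofReal, integral_norm_inv_ofReal_sub_sq hw.ne', abs_of_pos hw,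
    sub_zero, add_zero]
  · exact ((memLp_inv_ofReal_sub hw.ne').integrable_norm_pow two_ne_zero).ofReal.smul_const _
  · exact integrable_inv_sub_smul hcw.ne k
  · exact (((memLp_inv_ofReal_sub hw.ne').integrable_norm_pow two_ne_zero).ofReal.smul_const
      _).sub (integrable_inv_sub_smul hcw.ne k)
  · exact integrable_inv_sub_smul hcw.ne d

theorem IsHardyExtension.eq_zero_of_integral (hF : IsHardyExtension F f) {w : ℂ} (hw : 0 < w.im)
    (h : ∫ t : ℝ, ((‖((t : ℂ) - w)⁻¹‖ ^ 2 : ℝ) : ℂ) • f t = 0) : F w = 0 := by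
  rw [hF.integral_poisson_smul hw] at h
  refine (smul_eq_zero.1 h).resolve_left ?_
  exact_mod_cast (div_pos Real.pi_pos hw).ne'

/-- The Poisson kernel is positive and its mass is the factor `π / w.im` of the Poisson formula. -/
theorem IsHardyExtension.norm_le (hF : IsHardyExtension F f) {w : ℂ} (hw : 0 < w.im) {M : ℝ}
    (h : ∀ᵐ t : ℝ, ‖f t‖ ≤ M) : ‖F w‖ ≤ M := by
  have hle := norm_integral_le_of_norm_le
    (f := fun t : ℝ => ((‖((t : ℂ) - w)⁻¹‖ ^ 2 : ℝ) : ℂ) • f t)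
    (((memLp_inv_ofReal_sub hw.ne').integrable_norm_pow two_ne_zero).mul_const M) (by
      filter_upwards [h] with t ht
      rw [norm_smul, Complex.norm_real, norm_pow, norm_norm]
      gcongr)
  have hp : 0 < Real.pi / w.im := div_pos Real.pi_pos hw
  rw [hF.integral_poisson_smul hw, norm_smul, Complex.norm_real, integral_mul_const,
    integral_norm_inv_ofReal_sub_sq hw.ne', abs_of_pos hw, Real.norm_of_nonneg hp.le] at hle
  exact le_of_mul_le_mul_left hle hp

end Poisson

/-! ### The symbol at a point: uniqueness and bound -/

section Symbol

variable {H : Type*} [NormedAddCommGroup H] [NormedSpace ℂ H] [CompleteSpace H]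
  {X : L2R H →L[ℂ] L2R H}

/-- The value of `X f` at a point `w` of the upper half plane depends only on that of `f`. -/
theorem IsSimpleType.hardyExtension_apply_eq (hX : IsSimpleType X)
    (hhardy : ∀ f ∈ hardySpace H, X f ∈ hardySpace H) {F F' G G' : ℂ → H} {f f' : L2R H}
    (hF : IsHardyExtension F f) (hF' : IsHardyExtension F' f') (hG : IsHardyExtension G (X f))
    (hG' : IsHardyExtension G' (X f')) {w : ℂ} (hw : 0 < w.im) (h : F w = F' w) :
    G w = G' w := by
  obtain ⟨d, hd, hfd⟩ := (hF.sub hF').exists_eq_sub_smul hw (sub_eq_zero.2 h)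
  have hext := hG.sub hG'
  rw [← map_sub] at hext
  exact sub_eq_zero.1 (hext.eq_zero_of_integral hw
    (integral_poisson_smul_eq_zero (hhardy d hd) hw (hX.apply_ae_eq_smul hfd)))

/-- Only `F w` matters, so `f` may be replaced by `((w - conj w) / (t - conj w)) • F w`, whose norm
never exceeds `2 * ‖F w‖` on the line; locality and the Poisson bound do the rest. -/
theorem IsSimpleType.norm_hardyExtension_apply_le (hX : IsSimpleType X)
    (hhardy : ∀ f ∈ hardySpace H, X f ∈ hardySpace H) {F G : ℂ → H} {f : L2R H}
    (hF : IsHardyExtension F f) (hG : IsHardyExtension G (X f)) {w : ℂ} (hw : 0 < w.im) :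
    ‖G w‖ ≤ 2 * ‖X‖ * ‖F w‖ := by
  set c := (starRingEnd ℂ) w with hc
  have hcw : c.im < 0 := by simpa [hc] using hw
  have hwc : w - c ≠ 0 := sub_ne_zero_of_im_pos hcw hw
  have hK := isHardyExtension_cauchyKernel hcw ((w - c) • F w)
  obtain ⟨G', hG'⟩ := hhardy _ ⟨_, hK⟩
  rw [hX.hardyExtension_apply_eq hhardy hF hK hG hG' hw (by simp [smul_smul, hwc])]
  refine hG'.norm_le hw ?_
  filter_upwards [hX.norm_apply_ae_le (cauchyKernel H hcw.ne ((w - c) • F w)),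
    coeFn_cauchyKernel hcw.ne ((w - c) • F w)] with t h1 h2
  refine h1.trans ?_
  have h3 : ‖((t : ℂ) - c)⁻¹‖ ≤ w.im⁻¹ := by
    rw [norm_inv]
    refine inv_anti₀ hw (le_trans ?_ (Complex.abs_im_le_norm _))
    simp [hc, abs_of_pos hw]
  have h4 : ‖w - c‖ = 2 * w.im := by
    rw [hc, Complex.sub_conj]
    simp [abs_of_pos hw]
  rw [h2, norm_smul, norm_smul, h4]
  calc ‖X‖ * (‖((t : ℂ) - c)⁻¹‖ * (2 * w.im * ‖F w‖))
      ≤ ‖X‖ * (w.im⁻¹ * (2 * w.im * ‖F w‖)) := by gcongr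
    _ = 2 * ‖X‖ * ‖F w‖ := by field_simp

end Symbol

/-! ### Construction of the analytic symbol -/

theorem mainTheorem4 {H : Type*} [NormedAddCommGroup H] [InnerProductSpace ℂ H]
    [CompleteSpace H] [TopologicalSpace.SeparableSpace H]
    (X : L2R H →L[ℂ] L2R H) (hsimple : IsSimpleType X)
    (hhardy : ∀ f ∈ hardySpace H, X f ∈ hardySpace H) :
    ∃ S : ℂ → (H →L[ℂ] H),
      DifferentiableOn ℂ S UpperHalfPlane.upperHalfPlaneSet ∧
      (∃ C : ℝ, ∀ z ∈ UpperHalfPlane.upperHalfPlaneSet, ‖S z‖ ≤ C) ∧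
      ∀ (f : L2R H) (F G : ℂ → H), IsHardyExtension F f → IsHardyExtension G (X f) →
        ∀ z ∈ UpperHalfPlane.upperHalfPlaneSet, G z = S z (F z) := by
  -- With the pole fixed at `-i`, the kernel for `h` takes the value `(z + i)⁻¹ • h` at `z`. This
  -- forces `S z h = (z + i) • G h z`, visibly analytic in `z`.
  have hI : (-Complex.I).im < 0 := by simp
  have hK := fun h : H => isHardyExtension_cauchyKernel hI h
  have hex : ∀ h : H, ∃ G : ℂ → H, IsHardyExtension G (X (cauchyKernel H hI.ne h)) :=
    fun h => hhardy _ ⟨_, hK h⟩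
  choose G hG using hex
  have hne : ∀ z : ℂ, 0 < z.im → z - -Complex.I ≠ 0 := fun z hz => sub_ne_zero_of_im_pos hI hz
  have hadd : ∀ z : ℂ, 0 < z.im → ∀ h k, G (h + k) z = G h z + G k z := fun z hz h k => by
    have h1 := (hG h).add (hG k)
    rw [← map_add] at h1
    exact hsimple.hardyExtension_apply_eq hhardy (hK (h + k)) ((hK h).add (hK k)) (hG _) h1 hz
      (by simp)
  have hsmul : ∀ z : ℂ, 0 < z.im → ∀ (a : ℂ) (h : H), G (a • h) z = a • G h z :=
    fun z hz a h => by
      have h1 := (hG h).const_smul a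
      rw [← map_smul] at h1
      exact hsimple.hardyExtension_apply_eq hhardy (hK (a • h)) ((hK h).const_smul a) (hG _) h1 hz
        (by simp [smul_comm a])
  have hbound : ∀ z : ℂ, 0 < z.im → ∀ h,
      ‖(z - -Complex.I) • G h z‖ ≤ 2 * ‖X‖ * ‖h‖ := fun z hz h => by
    have h1 := hsimple.norm_hardyExtension_apply_le hhardy (hK h) (hG h) hz
    rw [norm_smul, norm_inv] at h1
    rw [norm_smul]
    have h2 : 0 < ‖z - -Complex.I‖ := norm_pos_iff.2 (hne z hz)
    calc ‖z - -Complex.I‖ * ‖G h z‖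
        ≤ ‖z - -Complex.I‖ * (2 * ‖X‖ * (‖z - -Complex.I‖⁻¹ * ‖h‖)) := by gcongr
      _ = 2 * ‖X‖ * ‖h‖ := by field_simp
  have hS : ∀ z : ℂ, ∃ T : H →L[ℂ] H, 0 < z.im →
      ‖T‖ ≤ 2 * ‖X‖ ∧ ∀ h, T h = (z - -Complex.I) • G h z := fun z => by
    by_cases hz : 0 < z.im
    · refine ⟨LinearMap.mkContinuous
        { toFun := fun h => (z - -Complex.I) • G h z
          map_add' := fun h k => by rw [hadd z hz, smul_add]
          map_smul' := fun a h => by rw [hsmul z hz, smul_comm, RingHom.id_apply] }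
        (2 * ‖X‖) (hbound z hz), fun _ => ⟨?_, fun h => rfl⟩⟩
      exact LinearMap.mkContinuous_norm_le _ (by positivity) _
    · exact ⟨0, fun h => absurd h hz⟩
  choose S hS using hS
  refine ⟨S, ?_, ⟨2 * ‖X‖, fun z hz => (hS z hz).1⟩, fun f F G' hF hG' z hz => ?_⟩
  · refine differentiableOn_of_forall_apply UpperHalfPlane.isOpen_upperHalfPlaneSet
      (fun z hz => (hS z hz).1) fun h => ?_
    refine DifferentiableOn.congr (f := fun z => (z - -Complex.I) • G h z) ?_
      fun z hz => (hS z hz).2 h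
    exact DifferentiableOn.smul (by fun_prop) (hG h).hardy.analytic
  · have hz' : 0 < z.im := hz
    rw [(hS z hz).2, ← Pi.smul_apply, ← Pi.smul_apply]
    -- For this fixed `z`, `f` is compared with the multiple of the kernel for the constant vector
    -- `F z` that agrees with `F` at `z`.
    refine hsimple.hardyExtension_apply_eq hhardy hF
      ((hK (F z)).const_smul (z - -Complex.I)) hG' ?_ hz' ?_
    · rw [map_smul]
      exact (hG (F z)).const_smul _
    · simp only [Pi.smul_apply, smul_smul]
      rw [mul_inv_cancel₀ (hne z hz'), one_smul]
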